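/- Let $A$ be a band operator on $\ell^2(\mathbb Z)$, i.e. a bounded linear operator whose matrix $(a_{ij})_{i,j\in\mathbb Z}$ is supported on finitely many diagonals, let $b\ge 1$ be an integer with $b\ge\max\{|i-j|:a_{ij}\ne0\}$, let $N\ge1$ and $n=Nb$. For $c\in\{0,\dots,b-1\}$ and $k,l\in\mathbb Z$ let $A^{(c)}_{k,l}=(a_{c+bk+p,\,c+bl+q})_{p,q=1}^{b}$, so that $A$ is block-tridiagonal with blocks $A^{(c)}_{k,l}$ for every offset $c$, and put, with the spectral norm of matrices, $$\delta_c=\delta_c(N)=2\Big(\sup_{l\in\mathbb Z}\|A^{(c)}_{l+1,l}\|+\sup_{l\in\mathbb Z}\|A^{(c)}_{l-1,l}\|\Big)\sin\frac{\pi}{2N+2}.$$ For a bounded operator $B$ let $\nu(B)=\inf_{\|x\|=1}\|Bx\|$. For $\varepsilon>0$ let $\mathrm{spec}_\varepsilon A=\{\lambda\in\mathbb C:\|(A-\lambda I)^{-1}\|>1/\varepsilon\}$, where $\|B^{-1}\|=\infty$ if $B$ is not invertible, and $$\Gamma^{n,c}_\varepsilon(A)=\bigcup_{k\in c+b\mathbb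 Z}\Big\{\lambda\in\mathbb C:\min\big(\nu((A-\lambda I)|_{\ell^2(J^n_k)}),\ \nu((A-\lambda I)^*|_{\ell^2(J^n_k)})\big)<\varepsilon\Big\},\qquad J^n_k=\{k+1,\dots,k+n\},$$ where $\ell^2(J)$ denotes the subspace of sequences in $\ell^2(\mathbb Z)$ supported in $J$. Then, for every $\varepsilon>0$ and $N\ge 1$, $$\Gamma^{n,c}_\varepsilon(A)\subset\mathrm{spec}_\varepsilon A\subset\Gamma^{n,c}_{\varepsilon+\delta_c}(A)\qquad\text{for each }c\in\{0,\dots,b-1\},$$ and hence $$\bigcup_{c=0}^{b-1}\Gamma^{n,c}_\varepsilon(A)\ \subset\ \mathrm{spec}_\varepsilon A\ \subset\ \bigcap_{c=0}^{b-1}\Gamma^{n,c}_{\varepsilon+\delta_c}(A);$$ the second inclusion also holds with every $\delta_c$ replaced by the common value $\delta=\max_{c}\delta_c$. Moreover, for each $c$, $\delta_c(N)\in O(1/N)=O(1/n)$ as $N\to\infty$ with $A$ and $b$ fixed. -/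

import Mathlib

noncomputable section

namespace BandOp

/-- The Hilbert space `ℓ²(ℤ)` of square-summable bi-infinite complex sequences. -/
abbrev L2Z : Type := lp (fun _ : ℤ => ℂ) 2

/-- The entry `a_{ij}` of the bi-infinite matrix of `A`: the `i`-th coordinate of `A e_j`. -/
def entry (A : L2Z →L[ℂ] L2Z) (i j : ℤ) : ℂ :=
  (A (lp.single 2 j (1 : ℂ))) i

/-- A band operator: a bounded operator whose matrix is supported on finitely many diagonals.
(The matrix entries are uniformly bounded, because `A` is bounded.) -/
def IsBandOperator (A : L2Z →L[ℂ] L2Z) : Prop :=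
  {m : ℤ | ∃ i j : ℤ, entry A i j ≠ 0 ∧ m = i - j}.Finite

/-- The bandwidth `max {|i - j| : a_{ij} ≠ 0}` of a band operator (`0` for the zero operator). -/
def bandwidth (A : L2Z →L[ℂ] L2Z) : ℕ :=
  sSup {m : ℕ | ∃ i j : ℤ, entry A i j ≠ 0 ∧ m = (i - j).natAbs}

/-- The `ε`-pseudospectrum: all `lam` with `‖(A - lam I)⁻¹‖ > 1 / ε`, where the norm of the
inverse counts as infinite if `A - lam I` is not invertible. -/
def pseudospectrum (A : L2Z →L[ℂ] L2Z) (ε : ℝ) : Set ℂ :=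
  {lam : ℂ | ¬ IsUnit (A - lam • (1 : L2Z →L[ℂ] L2Z)) ∨
    1 / ε < ‖Ring.inverse (A - lam • (1 : L2Z →L[ℂ] L2Z))‖}

/-- The lower norm `ν(B) = inf {‖B x‖ : ‖x‖ = 1}`. -/
def lowerNorm {E F : Type*} [NormedAddCommGroup E] [NormedSpace ℂ E]
    [NormedAddCommGroup F] [NormedSpace ℂ F] (B : E →L[ℂ] F) : ℝ :=
  ⨅ x : {x : E // ‖x‖ = 1}, ‖B x‖

/-- The discrete interval `J^n_k = {k + 1, …, k + n}`. -/
def window (n : ℕ) (k : ℤ) : Set ℤ := Set.Icc (k + 1) (k + n)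

/-- `ℓ²(J)` as the subspace of all sequences in `ℓ²(ℤ)` that vanish outside `J`. -/
def l2On (J : Set ℤ) : Submodule ℂ L2Z where
  carrier := {x | ∀ j, j ∉ J → x j = 0}
  zero_mem' := fun _ _ => rfl
  add_mem' := by
    intro x y hx hy j hj
    have h1 : x j = 0 := hx j hj
    have h2 : y j = 0 := hy j hj
    simp [h1, h2]
  smul_mem' := by
    intro a x hx j hj
    have h1 : x j = 0 := hx j hj
    simp [h1]

/-- The restriction `B|_{ℓ²(J)} : ℓ²(J) → ℓ²(ℤ)`. -/
def restrictTo (B : L2Z →L[ℂ] L2Z) (J : Set ℤ) : l2On J →L[ℂ] L2Z :=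
  B.comp (l2On J).subtypeL

/-- `Γ^{n,M}_ε(A)`, for a set `M` of window positions. -/
def gammaSet (A : L2Z →L[ℂ] L2Z) (n : ℕ) (M : Set ℤ) (ε : ℝ) : Set ℂ :=
  ⋃ k ∈ M, {lam : ℂ |
    min (lowerNorm (restrictTo (A - lam • (1 : L2Z →L[ℂ] L2Z)) (window n k)))
      (lowerNorm (restrictTo
        (ContinuousLinearMap.adjoint (A - lam • (1 : L2Z →L[ℂ] L2Z))) (window n k))) < ε}

/-- The set `c + bℤ`. -/
def offsetSet (b : ℕ) (c : ℤ) : Set ℤ := {k : ℤ | ∃ z : ℤ, k = c + b * z}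

/-- The `b × b` block `A_{kl}` for the offset `c`: rows `c + bk + 1, …, c + bk + b` and
columns `c + bl + 1, …, c + bl + b` of the matrix of `A`. -/
def block (A : L2Z →L[ℂ] L2Z) (b : ℕ) (c k l : ℤ) : Matrix (Fin b) (Fin b) ℂ :=
  Matrix.of fun p q => entry A (c + b * k + 1 + (p : ℕ)) (c + b * l + 1 + (q : ℕ))

/-- The operator norm of a matrix with respect to the Euclidean norm on `ℂ^b`. -/
def opNorm {b : ℕ} (M : Matrix (Fin b) (Fin b) ℂ) : ℝ :=
  ‖Matrix.toEuclideanCLM (n := Fin b) (𝕜 := ℂ) M‖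

/-- The error bound
`2 (sup_l ‖A_{l+1,l}‖ + sup_l ‖A_{l-1,l}‖) sin (π / (2N + 2))` for the offset `c`. -/
def delta (A : L2Z →L[ℂ] L2Z) (b : ℕ) (c : ℤ) (N : ℕ) : ℝ :=
  2 * ((⨆ l : ℤ, opNorm (block A b c (l + 1) l)) + (⨆ l : ℤ, opNorm (block A b c (l - 1) l))) *
    Real.sin (Real.pi / (2 * N + 2))

end BandOp

end

/-! For ε > 0, a point lies in the ε-pseudospectrum exactly when B = A - lam or its adjoint has a
vector x with ‖Bx‖ < ε‖x‖. A window vector is such a witness, which gives the first inclusion.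

For the second, x is localised. Let w be a weight that is constant on blocks and supported on N of
them, and let X_m be x multiplied by w translated by m. Summing over m gives ∑ ‖X_m‖² = S‖x‖² with S
= ∑ w², and likewise for Bx. The block diagonal of B commutes with the cutoff; in the two
neighbouring block diagonals the error is governed by the differences w(i) - w(i±1). With D the sum
of their squares and α, β the suprema of the off-diagonal block norms, Minkowski bounds the ℓ² norm
of (‖B X_m‖)_m by √S‖Bx‖ + (α + β)√D‖x‖, so some m has ‖B X_m‖ < (ε + (α + β)√(D/S))‖X_m‖.

The sine weight is the ground state of the discrete Dirichlet Laplacian on N points; it minimises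
D/S, with value (2 sin(π/(2N+2)))². The argument rests on `exists_cutoff`, `sum_sin_sub_sin_sq`,
`exists_norm_add_lt_of_hasSum` and `exists_window_norm_lt`. -/

noncomputable section

open scoped ENNReal

namespace BandOp

/-! ### Pseudospectra through almost-kernel vectors -/

section Hilbert

variable {H : Type*} [NormedAddCommGroup H] [InnerProductSpace ℂ H]

/-- An operator on a Hilbert space that is bounded below together with its adjoint is
invertible. -/
theorem isUnit_of_bounded_below [CompleteSpace H] {B : H →L[ℂ] H} {ε : ℝ} (hε : 0 < ε)
    (h : ∀ x, ε * ‖x‖ ≤ ‖B x‖) (h' : ∀ x, ε * ‖x‖ ≤ ‖ContinuousLinearMap.adjoint B x‖) :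
    IsUnit B := by
  rw [ContinuousLinearMap.isUnit_iff_bijective,
    ContinuousLinearMap.bijective_iff_dense_range_and_antilipschitz]
  constructor
  · rw [Submodule.topologicalClosure_eq_top_iff, ContinuousLinearMap.orthogonal_range,
      LinearMap.ker_eq_bot']
    intro x hx
    have h1 := h' x
    have h2 : ContinuousLinearMap.adjoint B x = 0 := hx
    rw [h2, norm_zero] at h1
    have : ‖x‖ ≤ 0 := by
      by_contra hc
      push Not at hc
      nlinarith [mul_pos hε hc]
    simpa using this
  · refine ⟨(Real.toNNReal ε)⁻¹, ?_⟩
    refine AddMonoidHomClass.antilipschitz_of_bound B fun x => ?_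
    rw [NNReal.coe_inv, Real.coe_toNNReal _ hε.le, inv_mul_eq_div, le_div_iff₀ hε, mul_comm]
    exact h x

theorem lt_norm_inverse_of_norm_lt {B : H →L[ℂ] H} (hB : IsUnit B) {ε : ℝ} (hε : 0 < ε) {x : H}
    (hx : ‖B x‖ < ε * ‖x‖) : 1 / ε < ‖Ring.inverse B‖ := by
  have h1 : Ring.inverse B (B x) = x := by
    have := congrArg (fun T : H →L[ℂ] H => T x) (Ring.inverse_mul_cancel B hB)
    simpa using this
  have h2 : ‖x‖ ≤ ‖Ring.inverse B‖ * ‖B x‖ := by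
    simpa only [h1] using (Ring.inverse B).le_opNorm (B x)
  have hx0 : 0 < ‖x‖ := by
    by_contra hc
    have : ‖x‖ = 0 := le_antisymm (not_lt.1 hc) (norm_nonneg x)
    rw [this, mul_zero] at hx
    exact absurd hx (not_lt.2 (norm_nonneg _))
  rw [div_lt_iff₀ hε]
  by_contra hc
  push Not at hc
  rcases (norm_nonneg (Ring.inverse B)).eq_or_lt with h0 | h0
  · rw [← h0, zero_mul] at h2
    linarith
  · have h4 : ‖Ring.inverse B‖ * ‖B x‖ < ‖Ring.inverse B‖ * (ε * ‖x‖) := by gcongr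
    nlinarith

theorem exists_norm_lt_of_lt_norm_inverse {B : H →L[ℂ] H} (hB : IsUnit B) {ε : ℝ} (hε : 0 < ε)
    (h : 1 / ε < ‖Ring.inverse B‖) : ∃ x, ‖B x‖ < ε * ‖x‖ := by
  by_contra! hc
  refine absurd h (not_lt.2 (ContinuousLinearMap.opNorm_le_bound _ (by positivity) fun y => ?_))
  have h1 : B (Ring.inverse B y) = y := by
    have := congrArg (fun T : H →L[ℂ] H => T y) (Ring.mul_inverse_cancel B hB)
    simpa using this
  have h2 := hc (Ring.inverse B y)
  rw [h1] at h2
  rw [one_div, inv_mul_eq_div, le_div_iff₀ hε, mul_comm]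
  exact h2

/-- The adjoint is needed because an operator that is bounded below may still fail to have dense
range. A witness for the adjoint of a unit works since B⁻¹ and its adjoint have equal norm. -/
theorem not_isUnit_or_lt_norm_inverse_iff [CompleteSpace H] (B : H →L[ℂ] H) {ε : ℝ} (hε : 0 < ε) :
    (¬ IsUnit B ∨ 1 / ε < ‖Ring.inverse B‖) ↔
      (∃ x, ‖B x‖ < ε * ‖x‖) ∨ ∃ x, ‖ContinuousLinearMap.adjoint B x‖ < ε * ‖x‖ := by
  constructor
  · intro h
    by_contra! hc
    have hB := isUnit_of_bounded_below hε hc.1 hc.2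
    rcases h with h | h
    · exact h hB
    · obtain ⟨x, hx⟩ := exists_norm_lt_of_lt_norm_inverse hB hε h
      exact absurd hx (not_lt.2 (hc.1 x))
  · intro h
    by_cases hB : IsUnit B
    · right
      rcases h with ⟨x, hx⟩ | ⟨x, hx⟩
      · exact lt_norm_inverse_of_norm_lt hB hε hx
      · rw [← ContinuousLinearMap.star_eq_adjoint] at hx
        have := lt_norm_inverse_of_norm_lt hB.star hε hx
        rwa [Ring.inverse_star, norm_star] at this
    · exact Or.inl hB

end Hilbert

theorem mem_pseudospectrum_iff (A : L2Z →L[ℂ] L2Z) {ε : ℝ} (hε : 0 < ε) (lam : ℂ) :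
    lam ∈ pseudospectrum A ε ↔
      (∃ x, ‖(A - lam • (1 : L2Z →L[ℂ] L2Z)) x‖ < ε * ‖x‖) ∨
        ∃ x, ‖ContinuousLinearMap.adjoint (A - lam • (1 : L2Z →L[ℂ] L2Z)) x‖ < ε * ‖x‖ :=
  not_isUnit_or_lt_norm_inverse_iff _ hε

/-- Normalising x turns one condition into the other; the strict inequality forces x ≠ 0. For empty
J the real infimum would default to 0, hence `hJ`. -/
theorem lowerNorm_restrictTo_lt_iff (B : L2Z →L[ℂ] L2Z) {J : Set ℤ} (hJ : J.Nonempty) (ε : ℝ) :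
    lowerNorm (restrictTo B J) < ε ↔ ∃ x ∈ l2On J, ‖B x‖ < ε * ‖x‖ := by
  constructor
  · intro h
    obtain ⟨j, hj⟩ := hJ
    have hmem : lp.single 2 j (1 : ℂ) ∈ l2On J := by
      intro i hi
      exact lp.single_apply_ne 2 j 1 (fun h => hi (h ▸ hj))
    have : Nonempty {x : l2On J // ‖x‖ = 1} := by
      refine ⟨⟨⟨_, hmem⟩, ?_⟩⟩
      rw [Submodule.coe_norm, lp.norm_single (by norm_num)]
      simp
    obtain ⟨⟨x, hx⟩, hlt⟩ := exists_lt_of_ciInf_lt h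
    refine ⟨x, x.2, ?_⟩
    rw [← Submodule.coe_norm, hx, mul_one]
    exact hlt
  · rintro ⟨x, hxJ, hx⟩
    have hx0 : 0 < ‖x‖ := by
      by_contra hc
      have : ‖x‖ = 0 := le_antisymm (not_lt.1 hc) (norm_nonneg x)
      rw [this, mul_zero] at hx
      exact absurd hx (not_lt.2 (norm_nonneg _))
    let y : l2On J := ((‖x‖⁻¹ : ℝ) : ℂ) • ⟨x, hxJ⟩
    have hy : ‖y‖ = 1 := by
      rw [norm_smul, Submodule.coe_norm]
      simp [hx0.ne']
    refine lt_of_le_of_lt (ciInf_le (f := fun z : {z : l2On J // ‖z‖ = 1} => ‖restrictTo B J z‖)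
      ⟨0, ?_⟩ ⟨y, hy⟩) ?_
    · rintro _ ⟨z, rfl⟩
      exact norm_nonneg _
    · have : restrictTo B J y = ((‖x‖⁻¹ : ℝ) : ℂ) • B x := by
        simp only [y, map_smul]
        rfl
      simp only [this, norm_smul, Complex.norm_real, norm_inv, norm_norm]
      rw [inv_mul_lt_iff₀ hx0, mul_comm]
      exact hx

theorem window_nonempty {n : ℕ} (hn : 0 < n) (k : ℤ) : (window n k).Nonempty :=
  ⟨k + 1, by simp only [window, Set.mem_Icc]; omega⟩

theorem mem_gammaSet_iff (A : L2Z →L[ℂ] L2Z) {n : ℕ} (hn : 0 < n) (M : Set ℤ) (ε : ℝ) (lam : ℂ) :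
    lam ∈ gammaSet A n M ε ↔ ∃ k ∈ M,
      (∃ x ∈ l2On (window n k), ‖(A - lam • (1 : L2Z →L[ℂ] L2Z)) x‖ < ε * ‖x‖) ∨
      ∃ x ∈ l2On (window n k),
        ‖ContinuousLinearMap.adjoint (A - lam • (1 : L2Z →L[ℂ] L2Z)) x‖ < ε * ‖x‖ := by
  simp only [gammaSet, Set.mem_iUnion, Set.mem_ofPred_eq, min_lt_iff, exists_prop,
    lowerNorm_restrictTo_lt_iff _ (window_nonempty hn _)]

theorem gammaSet_subset_pseudospectrum (A : L2Z →L[ℂ] L2Z) {n : ℕ} (hn : 0 < n) (M : Set ℤ)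
    {ε : ℝ} (hε : 0 < ε) : gammaSet A n M ε ⊆ pseudospectrum A ε := by
  intro lam h
  rw [mem_gammaSet_iff A hn] at h
  rw [mem_pseudospectrum_iff A hε]
  obtain ⟨k, -, ⟨x, -, hx⟩ | ⟨x, -, hx⟩⟩ := h
  · exact Or.inl ⟨x, hx⟩
  · exact Or.inr ⟨x, hx⟩

theorem gammaSet_mono (A : L2Z →L[ℂ] L2Z) (n : ℕ) (M : Set ℤ) {ε ε' : ℝ} (h : ε ≤ ε') :
    gammaSet A n M ε ⊆ gammaSet A n M ε' :=
  Set.iUnion₂_mono fun _ _ _ hlam => lt_of_lt_of_le hlam h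

/-! ### Square sums -/

/-- Extended nonnegative sums can be reordered without summability conditions. -/
theorem enorm_sq_eq_tsum (x : L2Z) : ‖x‖ₑ ^ 2 = ∑' i, ‖x i‖ₑ ^ 2 := by
  have h := lp.hasSum_norm (p := 2) (by norm_num) x
  simp only [ENNReal.toReal_ofNat, Real.rpow_ofNat] at h
  have h1 : ∀ {E : Type} [NormedAddCommGroup E] (z : E), ‖z‖ₑ ^ 2 = ENNReal.ofReal (‖z‖ ^ 2) := by
    intro E _ z
    rw [ENNReal.ofReal_pow (norm_nonneg z), ofReal_norm]
  rw [h1 x, ← h.tsum_eq, ENNReal.ofReal_tsum_of_nonneg (fun i => by positivity) h.summable]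
  exact tsum_congr fun i => (h1 (x i)).symm

theorem exists_coe_eq_of_tsum_ne_top (f : ℤ → ℂ) (hf : ∑' i, ‖f i‖ₑ ^ 2 ≠ ⊤) :
    ∃ y : L2Z, ∀ i, y i = f i := by
  have : Memℓp f 2 := by
    refine memℓp_gen ?_
    simpa using ENNReal.summable_toReal hf
  exact ⟨⟨f, this⟩, fun i => rfl⟩

theorem norm_le_of_enorm_sq_le {E F : Type*} [NormedAddCommGroup E] [NormedAddCommGroup F]
    {y : E} {z : F} {C : ℝ} (hC : 0 ≤ C) (h : ‖y‖ₑ ^ 2 ≤ ENNReal.ofReal C ^ 2 * ‖z‖ₑ ^ 2) :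
    ‖y‖ ≤ C * ‖z‖ := by
  rw [← mul_pow, ← ofReal_norm, ← ofReal_norm, ← ENNReal.ofReal_mul hC] at h
  have h' := (ENNReal.pow_le_pow_left_iff two_ne_zero).1 h
  exact (ENNReal.ofReal_le_ofReal_iff (by positivity)).1 h'

theorem hasSum_of_tsum_ofReal_eq {ι : Type*} {f : ι → ℝ} (hf : ∀ i, 0 ≤ f i) {S : ℝ} (hS : 0 ≤ S)
    (h : ∑' i, ENNReal.ofReal (f i) = ENNReal.ofReal S) : HasSum f S := by
  have h1 : Summable f := by
    have := ENNReal.summable_toReal (f := fun i => ENNReal.ofReal (f i)) (by simp [h])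
    simpa [ENNReal.toReal_ofReal (hf _)] using this
  rw [← ENNReal.ofReal_tsum_of_nonneg hf h1,
    ENNReal.ofReal_eq_ofReal_iff (tsum_nonneg hf) hS] at h
  exact h ▸ h1.hasSum

/-! ### Block decomposition of `ℤ` -/

/-- The number of the block of length `b` (with offset `c`) that contains `j`. -/
def blockIndex (b : ℕ) (c j : ℤ) : ℤ := (j - c - 1) / b

/-- The decomposition of `ℤ` into consecutive blocks of length `b`, with offset `c`. -/
def blockEquiv (b : ℕ) [NeZero b] (c : ℤ) : ℤ × Fin b ≃ ℤ :=
  (Int.divModEquiv b).symm.trans (Equiv.addLeft (c + 1))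

theorem blockEquiv_apply (b : ℕ) [NeZero b] (c k : ℤ) (p : Fin b) :
    blockEquiv b c (k, p) = c + b * k + 1 + (p : ℕ) := by
  simp [blockEquiv]
  ring

theorem blockIndex_blockEquiv (b : ℕ) [NeZero b] (c k : ℤ) (p : Fin b) :
    blockIndex b c (blockEquiv b c (k, p)) = k := by
  have hb : (b : ℤ) ≠ 0 := by exact_mod_cast NeZero.ne b
  have hp : ((p : ℕ) : ℤ) < b := by exact_mod_cast p.2
  rw [blockEquiv_apply, blockIndex,
    show c + b * k + 1 + (p : ℕ) - c - 1 = ((p : ℕ) : ℤ) + b * k by ring,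
    Int.add_mul_ediv_left _ _ hb, Int.ediv_eq_zero_of_lt (by positivity) hp, zero_add]

/-- The part of the `i`-th row of `A x` that comes from the `s`-th block diagonal. -/
def diagPart (A : L2Z →L[ℂ] L2Z) (b : ℕ) [NeZero b] (c s : ℤ) (x : ℤ → ℂ) (i : ℤ) : ℂ :=
  ∑ q : Fin b, entry A i (blockEquiv b c (blockIndex b c i + s, q)) *
    x (blockEquiv b c (blockIndex b c i + s, q))

theorem hasSum_entry_mul (A : L2Z →L[ℂ] L2Z) (x : L2Z) (i : ℤ) :
    HasSum (fun j => entry A i j * x j) (A x i) := by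
  have h1 := (A.hasSum (lp.hasSum_single (p := 2) (by norm_num) x))
  have h2 := h1.mapL (lp.evalCLM ℂ (fun _ : ℤ => ℂ) 2 i)
  have h3 : ∀ j, entry A i j * x j =
      lp.evalCLM ℂ (fun _ : ℤ => ℂ) 2 i (A (lp.single 2 j (x j))) := by
    intro j
    have : lp.single 2 j (x j) = (x j) • lp.single (E := fun _ : ℤ => ℂ) 2 j (1 : ℂ) := by
      rw [← lp.single_smul]; simp
    rw [this, map_smul, map_smul, smul_eq_mul, mul_comm]
    rfl
  simp only [h3]
  exact h2

/-- Indices in blocks at distance at least 2 differ by at least 2b - (b - 1) = b + 1, beyond the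
bandwidth. -/
theorem apply_eq_sum_diagPart (A : L2Z →L[ℂ] L2Z) {b : ℕ} [NeZero b]
    (hA : ∀ i j, entry A i j ≠ 0 → (i - j).natAbs ≤ b) (c : ℤ) (x : L2Z) (i : ℤ) :
    A x i = diagPart A b c 0 x i + diagPart A b c (-1) x i + diagPart A b c 1 x i := by
  set k := blockIndex b c i with hk
  obtain ⟨⟨k', p⟩, hi⟩ := (blockEquiv b c).surjective i
  have hkk : k' = k := by rw [hk, ← hi, blockIndex_blockEquiv]
  rw [hkk] at hi
  have hp := p.2
  rw [blockEquiv_apply] at hi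
  have h := (blockEquiv b c).hasSum_iff.2 (hasSum_entry_mul A x i)
  have h0 : ∀ t ∉ ({k, k - 1, k + 1} : Finset ℤ) ×ˢ (Finset.univ : Finset (Fin b)),
      ((fun j => entry A i j * x j) ∘ blockEquiv b c) t = 0 := by
    rintro ⟨l, q⟩ ht
    have hq := q.2
    simp only [Finset.mem_product, Finset.mem_insert, Finset.mem_singleton, Finset.mem_univ,
      and_true, not_or] at ht
    have : entry A i (blockEquiv b c (l, q)) = 0 := by
      by_contra hne
      have h1 := hA _ _ hne
      rw [blockEquiv_apply, ← hi,
        show c + b * k + 1 + (p : ℕ) - (c + b * l + 1 + (q : ℕ)) =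
          b * (k - l) + ((p : ℕ) - (q : ℕ) : ℤ) by ring] at h1
      have h2 : k - l ≤ -2 ∨ 2 ≤ k - l := by omega
      rcases h2 with h2 | h2
      · have : (b : ℤ) * (k - l) ≤ b * (-2) := by gcongr
        omega
      · have : (b : ℤ) * 2 ≤ b * (k - l) := by gcongr
        omega
    simp [this]
  have hk₁ : k ∉ ({k - 1, k + 1} : Finset ℤ) := by
    simp only [Finset.mem_insert, Finset.mem_singleton]
    omega
  have hk₂ : k - 1 ∉ ({k + 1} : Finset ℤ) := by
    simp only [Finset.mem_singleton]
    omega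
  rw [← h.tsum_eq, tsum_eq_sum h0, Finset.sum_product, Finset.sum_insert hk₁,
    Finset.sum_insert hk₂, Finset.sum_singleton]
  simp only [diagPart, ← hk, add_zero, Function.comp_apply, ← sub_eq_add_neg, add_assoc]

theorem tsum_eq_tsum_block (b : ℕ) [NeZero b] (c : ℤ) (f : ℤ → ℝ≥0∞) :
    ∑' i, f i = ∑' k : ℤ, ∑ p : Fin b, f (blockEquiv b c (k, p)) := by
  rw [← (blockEquiv b c).tsum_eq, ENNReal.tsum_prod']
  simp only [tsum_fintype]

/-- Output block k depends only on input block k + s, so the block estimates add up after a shift of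
the index. -/
theorem tsum_diagPart_le (A : L2Z →L[ℂ] L2Z) (b : ℕ) [NeZero b] (c s : ℤ) {α : ℝ}
    (hα : ∀ k, opNorm (block A b c k (k + s)) ≤ α) (x : ℤ → ℂ) :
    ∑' i, ‖diagPart A b c s x i‖ₑ ^ 2 ≤ ENNReal.ofReal α ^ 2 * ∑' i, ‖x i‖ₑ ^ 2 := by
  have hnorm : ∀ v : EuclideanSpace ℂ (Fin b), ‖v‖ₑ ^ 2 = ∑ p, ‖v p‖ₑ ^ 2 := by
    intro v
    rw [← ofReal_norm, ← ENNReal.ofReal_pow (norm_nonneg _), EuclideanSpace.norm_sq_eq,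
      ENNReal.ofReal_sum_of_nonneg (fun i _ => by positivity)]
    exact Finset.sum_congr rfl fun i _ => by
      rw [ENNReal.ofReal_pow (norm_nonneg _), ofReal_norm]
  let v : ℤ → EuclideanSpace ℂ (Fin b) := fun k =>
    WithLp.toLp 2 fun q => x (blockEquiv b c (k, q))
  have hrow : ∀ k, ∑ p : Fin b, ‖diagPart A b c s x (blockEquiv b c (k, p))‖ₑ ^ 2 =
      ‖Matrix.toEuclideanCLM (n := Fin b) (𝕜 := ℂ) (block A b c k (k + s)) (v (k + s))‖ₑ ^ 2 := by
    intro k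
    rw [hnorm]
    refine Finset.sum_congr rfl fun p _ => ?_
    congr 2
    simp only [diagPart, blockIndex_blockEquiv, v, Matrix.toEuclideanCLM_toLp, Matrix.mulVec,
      dotProduct, block, Matrix.of_apply]
    simp only [blockEquiv_apply]
  rw [tsum_eq_tsum_block b c, tsum_eq_tsum_block b c (fun i => ‖x i‖ₑ ^ 2), ← ENNReal.tsum_mul_left,
    ← (Equiv.addRight s).tsum_eq (fun k => ENNReal.ofReal α ^ 2 *
      ∑ p : Fin b, ‖x (blockEquiv b c (k, p))‖ₑ ^ 2)]
  refine ENNReal.tsum_le_tsum fun k => ?_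
  have h1 : ∑ p : Fin b, ‖x (blockEquiv b c (k + s, p))‖ₑ ^ 2 = ‖v (k + s)‖ₑ ^ 2 := by
    rw [hnorm]
  rw [hrow, Equiv.coe_addRight, h1, ← mul_pow]
  gcongr
  rw [← ofReal_norm, ← ofReal_norm, ← ENNReal.ofReal_mul ((norm_nonneg _).trans (hα k))]
  refine ENNReal.ofReal_le_ofReal ?_
  refine (ContinuousLinearMap.le_opNorm _ _).trans ?_
  gcongr
  exact hα k

theorem exists_diagPart (A : L2Z →L[ℂ] L2Z) (b : ℕ) [NeZero b] (c s : ℤ) {α : ℝ}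
    (hα : ∀ k, opNorm (block A b c k (k + s)) ≤ α) (x : L2Z) :
    ∃ y : L2Z, (∀ i, y i = diagPart A b c s x i) ∧ ‖y‖ ≤ α * ‖x‖ := by
  have h := tsum_diagPart_le A b c s hα x
  rw [← enorm_sq_eq_tsum] at h
  have hfin : ENNReal.ofReal α ^ 2 * ‖x‖ₑ ^ 2 ≠ ⊤ := by finiteness
  obtain ⟨y, hy⟩ := exists_coe_eq_of_tsum_ne_top _ (ne_top_of_le_ne_top hfin h)
  refine ⟨y, hy, norm_le_of_enorm_sq_le ((norm_nonneg _).trans (hα 0)) ?_⟩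
  rw [enorm_sq_eq_tsum y]
  simpa only [hy] using h

/-! ### Cutting off by translates of a weight -/

/-- By Tonelli, each |x_j|² is counted with total weight ∑ over m of w(k - m)² = S, whatever the
block k of j. -/
theorem exists_cutoff (b : ℕ) (c : ℤ) {w : ℤ → ℝ} {S : ℝ} (hw : HasSum (fun i => w i ^ 2) S)
    (x : L2Z) : ∃ X : ℤ → L2Z, (∀ m j, X m j = w (blockIndex b c j - m) * x j) ∧
      HasSum (fun m => ‖X m‖ ^ 2) (S * ‖x‖ ^ 2) := by
  have hS : 0 ≤ S := hw.nonneg fun i => sq_nonneg _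
  have hw' : ∀ k : ℤ, ∑' m : ℤ, ‖w (k - m)‖ₑ ^ 2 = ENNReal.ofReal S := by
    intro k
    rw [show ∑' m : ℤ, ‖w (k - m)‖ₑ ^ 2 = ∑' i, ‖w i‖ₑ ^ 2 from
        (Equiv.subLeft k).tsum_eq (fun i => ‖w i‖ₑ ^ 2), ← hw.tsum_eq,
      ENNReal.ofReal_tsum_of_nonneg (fun i => sq_nonneg _) hw.summable]
    refine tsum_congr fun i => ?_
    rw [← sq_abs, ENNReal.ofReal_pow (abs_nonneg _), ← Real.norm_eq_abs, ofReal_norm]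
  have htot : ∑' m : ℤ, ∑' j, ‖(w (blockIndex b c j - m) : ℂ) * x j‖ₑ ^ 2 =
      ENNReal.ofReal (S * ‖x‖ ^ 2) := by
    rw [ENNReal.tsum_comm]
    have : ∀ j m, ‖(w (blockIndex b c j - m) : ℂ) * x j‖ₑ ^ 2 =
        ‖w (blockIndex b c j - m)‖ₑ ^ 2 * ‖x j‖ₑ ^ 2 := by
      intro j m
      rw [enorm_mul, mul_pow, ← ofReal_norm, Complex.norm_real, ofReal_norm]
    simp only [this, ENNReal.tsum_mul_right, hw', ENNReal.tsum_mul_left]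
    rw [← enorm_sq_eq_tsum, ENNReal.ofReal_mul hS, ENNReal.ofReal_pow (norm_nonneg _),
      ofReal_norm]
  have hex : ∀ m : ℤ, ∃ y : L2Z, ∀ j, y j = (w (blockIndex b c j - m) : ℂ) * x j := fun m =>
    exists_coe_eq_of_tsum_ne_top _
      (ne_top_of_le_ne_top (htot ▸ ENNReal.ofReal_ne_top) (ENNReal.le_tsum m))
  choose X hX using hex
  refine ⟨X, hX, hasSum_of_tsum_ofReal_eq (fun m => sq_nonneg _) (by positivity) ?_⟩
  rw [← htot]
  refine tsum_congr fun m => ?_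
  rw [ENNReal.ofReal_pow (norm_nonneg _), ofReal_norm, enorm_sq_eq_tsum]
  simp only [hX]

theorem diagPart_cutoff (A : L2Z →L[ℂ] L2Z) (b : ℕ) [NeZero b] (c s m : ℤ) {w : ℤ → ℝ}
    {x X : ℤ → ℂ} (hX : ∀ j, X j = w (blockIndex b c j - m) * x j) (i : ℤ) :
    diagPart A b c s X i = w (blockIndex b c i + s - m) * diagPart A b c s x i := by
  simp only [diagPart, hX, blockIndex_blockEquiv, Finset.mul_sum]
  exact Finset.sum_congr rfl fun q _ => by ring

/-! ### The sine weight -/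

/-- The weight `sin (i π / (N + 1))` for `1 ≤ i ≤ N`, extended by zero. -/
def sineWeight (N : ℕ) (i : ℤ) : ℝ :=
  if 1 ≤ i ∧ i ≤ N then Real.sin (i * (Real.pi / (N + 1))) else 0

theorem sineWeight_natCast {N j : ℕ} (hj : j ≤ N + 1) :
    sineWeight N j = Real.sin (j * (Real.pi / (N + 1))) := by
  unfold sineWeight
  split_ifs with h
  · simp
  · have : j = 0 ∨ j = N + 1 := by omega
    rcases this with rfl | rfl
    · simp
    · have h0 : ((N + 1 : ℕ) : ℝ) * (Real.pi / (N + 1)) = Real.pi := by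
        push_cast
        field_simp
      rw [h0, Real.sin_pi]

theorem hasSum_of_eq_zero_off_range {M : Type*} [AddCommMonoid M] [TopologicalSpace M]
    {f : ℤ → M} {n : ℕ} (h : ∀ i, (i < 0 ∨ (n : ℤ) ≤ i) → f i = 0) :
    HasSum f (∑ j ∈ Finset.range n, f j) := by
  have := hasSum_sum_of_ne_finset_zero (L := .unconditional ℤ) (f := f)
    (s := (Finset.range n).map Nat.castEmbedding) (by
      intro i hi
      refine h i ?_
      by_contra hc
      refine hi ?_
      simp only [Finset.mem_map, Finset.mem_range, Nat.castEmbedding_apply]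
      exact ⟨i.toNat, by omega, by omega⟩)
  simpa using this

theorem hasSum_sineWeight_sq (N : ℕ) : HasSum (fun i => sineWeight N i ^ 2)
    (∑ j ∈ Finset.range (N + 1), Real.sin (j * (Real.pi / (N + 1))) ^ 2) := by
  have h := hasSum_of_eq_zero_off_range (f := fun i => sineWeight N i ^ 2) (n := N + 1) (by
    intro i hi
    rw [sineWeight, if_neg (by push_cast at hi; omega)]
    simp)
  convert h using 1
  refine Finset.sum_congr rfl fun j hj => ?_
  rw [sineWeight_natCast (by simp at hj; omega)]

/-- Summation by parts for an eigenvector of the second difference, with eigenvalue 2 - 2 cos θ. The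
boundary term vanishes when nθ = π. -/
theorem sum_sin_sub_sin_sq (θ : ℝ) (n : ℕ) :
    ∑ j ∈ Finset.range n, (Real.sin (j * θ) - Real.sin ((j + 1) * θ)) ^ 2 =
      (2 * Real.sin (θ / 2)) ^ 2 * ∑ j ∈ Finset.range n, Real.sin (j * θ) ^ 2 +
        Real.sin (n * θ) * (Real.sin (n * θ) - Real.sin ((n - 1) * θ)) := by
  have hθ : (2 * Real.sin (θ / 2)) ^ 2 = 2 - 2 * Real.cos θ := by
    have h1 := Real.cos_sq_add_sin_sq (θ / 2)
    have h2 := Real.cos_two_mul (θ / 2)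
    rw [show 2 * (θ / 2) = θ by ring] at h2
    rw [h2]
    nlinarith
  rw [hθ]
  induction n with
  | zero => simp
  | succ n ih =>
    rw [Finset.sum_range_succ, Finset.sum_range_succ, ih]
    push_cast
    rw [show ((n : ℝ) + 1 - 1) * θ = n * θ by ring,
      show ((n : ℝ) + 1) * θ = n * θ + θ by ring, show ((n : ℝ) - 1) * θ = n * θ - θ by ring,
      Real.sin_add, Real.sin_sub]
    ring

theorem hasSum_sineWeight_sub_sq (N : ℕ) :
    HasSum (fun i => (sineWeight N i - sineWeight N (i + 1)) ^ 2)
      ((2 * Real.sin (Real.pi / (2 * N + 2))) ^ 2 *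
        ∑ j ∈ Finset.range (N + 1), Real.sin (j * (Real.pi / (N + 1))) ^ 2) := by
  have h := hasSum_of_eq_zero_off_range
    (f := fun i => (sineWeight N i - sineWeight N (i + 1)) ^ 2) (n := N + 1) (by
      intro i hi
      push_cast at hi
      rw [sineWeight, if_neg (by omega), sineWeight, if_neg (by omega)]
      simp)
  convert h using 1
  have h1 := sum_sin_sub_sin_sq (Real.pi / (N + 1)) (N + 1)
  have h0 : ((N + 1 : ℕ) : ℝ) * (Real.pi / (N + 1)) = Real.pi := by
    push_cast
    field_simp
  rw [h0, Real.sin_pi, zero_mul, add_zero, div_div,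
    show ((N : ℝ) + 1) * 2 = 2 * N + 2 by ring] at h1
  rw [← h1]
  refine Finset.sum_congr rfl fun j hj => ?_
  have hj' : j < N + 1 := Finset.mem_range.1 hj
  have h2 := sineWeight_natCast (N := N) (j := j + 1) (by omega)
  push_cast at h2
  rw [h2, sineWeight_natCast (by omega)]

theorem hasSum_sineWeight_sub_sq' (N : ℕ) :
    HasSum (fun i => (sineWeight N i - sineWeight N (i - 1)) ^ 2)
      ((2 * Real.sin (Real.pi / (2 * N + 2))) ^ 2 *
        ∑ j ∈ Finset.range (N + 1), Real.sin (j * (Real.pi / (N + 1))) ^ 2) := by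
  have h := (Equiv.subRight (1 : ℤ)).hasSum_iff.2 (hasSum_sineWeight_sub_sq N)
  convert h using 2 with i
  simp only [Function.comp_apply, Equiv.subRight_apply, sub_add_cancel]
  ring

theorem sum_sin_sq_pos {N : ℕ} (hN : 0 < N) :
    0 < ∑ j ∈ Finset.range (N + 1), Real.sin (j * (Real.pi / (N + 1))) ^ 2 := by
  refine Finset.sum_pos' (fun j _ => sq_nonneg _) ⟨1, by simp; omega, ?_⟩
  have hN' : (1 : ℝ) ≤ N := by exact_mod_cast hN
  have : 0 < Real.sin (((1 : ℕ) : ℝ) * (Real.pi / (N + 1))) := by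
    rw [Nat.cast_one, one_mul]
    refine Real.sin_pos_of_pos_of_lt_pi (by positivity) ?_
    exact div_lt_self Real.pi_pos (by linarith)
  positivity

/-! ### Localisation -/

theorem sqrt_sum_norm_sq_add_le {ι E : Type*} [NormedAddCommGroup E] (s : Finset ι)
    (u v w : ι → E) :
    √(∑ m ∈ s, ‖u m + v m + w m‖ ^ 2) ≤
      √(∑ m ∈ s, ‖u m‖ ^ 2) + √(∑ m ∈ s, ‖v m‖ ^ 2) + √(∑ m ∈ s, ‖w m‖ ^ 2) := by
  let T : (ι → E) → PiLp 2 (fun _ : s => E) := fun f => WithLp.toLp 2 fun m => f m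
  have hT : ∀ f : ι → E, ‖T f‖ = √(∑ m ∈ s, ‖f m‖ ^ 2) := by
    intro f
    rw [PiLp.norm_eq_of_L2, ← Finset.sum_coe_sort s]
  have h := norm_add₃_le (a := T u) (b := T v) (c := T w)
  rw [hT, hT, hT] at h
  rw [← hT (fun m => u m + v m + w m)]
  exact h

theorem sqrt_sum_norm_sq_le {ι E F : Type*} [NormedAddCommGroup E] [NormedAddCommGroup F]
    {y : ι → E} {z : ι → F} {α t : ℝ} (hα : 0 ≤ α) (h : ∀ m, ‖y m‖ ≤ α * ‖z m‖)
    (hz : HasSum (fun m => ‖z m‖ ^ 2) t) (s : Finset ι) :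
    √(∑ m ∈ s, ‖y m‖ ^ 2) ≤ α * √t := by
  rw [← Real.sqrt_sq hα, ← Real.sqrt_mul (sq_nonneg α)]
  refine Real.sqrt_le_sqrt ?_
  calc ∑ m ∈ s, ‖y m‖ ^ 2 ≤ ∑ m ∈ s, α ^ 2 * ‖z m‖ ^ 2 := by
        refine Finset.sum_le_sum fun m _ => ?_
        rw [← mul_pow]
        exact pow_le_pow_left₀ (norm_nonneg _) (h m) 2
    _ = α ^ 2 * ∑ m ∈ s, ‖z m‖ ^ 2 := by rw [Finset.mul_sum]
    _ ≤ α ^ 2 * t := by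
        gcongr
        exact sum_le_hasSum _ (fun m _ => sq_nonneg _) hz

/-- Otherwise, summing squares over m and applying Minkowski gives (ε + (α + β)τ)√S a ≤ √S r + (α +
β)τ√S a, against r < εa. -/
theorem exists_norm_add_lt_of_hasSum {ι E : Type*} [NormedAddCommGroup E]
    {X U Y Z P Q : ι → E} {S r a τ α β ε : ℝ} (hS : 0 < S) (hr : 0 ≤ r) (ha : 0 ≤ a) (hτ : 0 ≤ τ)
    (hα : 0 ≤ α) (hβ : 0 ≤ β) (hε : 0 < ε)
    (hX : HasSum (fun m => ‖X m‖ ^ 2) (S * a ^ 2)) (hU : HasSum (fun m => ‖U m‖ ^ 2) (S * r ^ 2))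
    (hP : HasSum (fun m => ‖P m‖ ^ 2) (τ ^ 2 * S * a ^ 2))
    (hQ : HasSum (fun m => ‖Q m‖ ^ 2) (τ ^ 2 * S * a ^ 2))
    (hY : ∀ m, ‖Y m‖ ≤ α * ‖P m‖) (hZ : ∀ m, ‖Z m‖ ≤ β * ‖Q m‖) (hra : r < ε * a) :
    ∃ m, ‖U m + Y m + Z m‖ < (ε + (α + β) * τ) * ‖X m‖ := by
  by_contra! hex
  have hSs : 0 < √S := Real.sqrt_pos.2 hS
  have e1 : √(S * r ^ 2) = √S * r := by rw [Real.sqrt_mul hS.le, Real.sqrt_sq hr]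
  have e2 : √(τ ^ 2 * S * a ^ 2) = τ * √S * a := by
    rw [Real.sqrt_mul (by positivity), Real.sqrt_sq ha, Real.sqrt_mul (by positivity),
      Real.sqrt_sq hτ]
  -- Finite sums suffice: only the smaller side has to be summable, and `hX` provides that.
  have hfin : ∀ s : Finset ι, ∑ m ∈ s, (ε + (α + β) * τ) ^ 2 * ‖X m‖ ^ 2 ≤
      (√S * r + α * (τ * √S * a) + β * (τ * √S * a)) ^ 2 := by
    intro s
    have h1 := sqrt_sum_norm_sq_add_le s U Y Z
    have h2 := sqrt_sum_norm_sq_le (y := U) zero_le_one (fun m => (one_mul _).ge) hU s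
    have h3 := sqrt_sum_norm_sq_le hα hY hP s
    have h4 := sqrt_sum_norm_sq_le hβ hZ hQ s
    rw [e1] at h2
    rw [e2] at h3 h4
    calc ∑ m ∈ s, (ε + (α + β) * τ) ^ 2 * ‖X m‖ ^ 2
        ≤ ∑ m ∈ s, ‖U m + Y m + Z m‖ ^ 2 := by
          refine Finset.sum_le_sum fun m _ => ?_
          rw [← mul_pow]
          exact pow_le_pow_left₀ (by positivity) (hex m) 2
      _ = √(∑ m ∈ s, ‖U m + Y m + Z m‖ ^ 2) ^ 2 :=
          (Real.sq_sqrt (Finset.sum_nonneg fun m _ => sq_nonneg _)).symm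
      _ ≤ _ := pow_le_pow_left₀ (Real.sqrt_nonneg _) (by linarith) 2
  have hlim := hasSum_le_of_sum_le (hX.mul_left ((ε + (α + β) * τ) ^ 2)) hfin
  have e3 : (ε + (α + β) * τ) ^ 2 * (S * a ^ 2) = ((ε + (α + β) * τ) * (√S * a)) ^ 2 := by
    rw [mul_pow, mul_pow, Real.sq_sqrt hS.le]
  rw [e3] at hlim
  have h5 := (pow_le_pow_iff_left₀ (by positivity) (by positivity) two_ne_zero).1 hlim
  have h6 : √S * r < √S * (ε * a) := by gcongr
  linarith

theorem exists_window_norm_lt (A : L2Z →L[ℂ] L2Z) {b : ℕ} [NeZero b]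
    (hA : ∀ i j, entry A i j ≠ 0 → (i - j).natAbs ≤ b) (c : ℤ) {N : ℕ} (hN : 0 < N) {α β : ℝ}
    (hα : ∀ k, opNorm (block A b c k (k + -1)) ≤ α) (hβ : ∀ k, opNorm (block A b c k (k + 1)) ≤ β)
    (lam : ℂ) {ε : ℝ} (hε : 0 < ε) {x : L2Z}
    (hx : ‖(A - lam • (1 : L2Z →L[ℂ] L2Z)) x‖ < ε * ‖x‖) :
    ∃ k ∈ offsetSet b c, ∃ y ∈ l2On (window (N * b) k),
      ‖(A - lam • (1 : L2Z →L[ℂ] L2Z)) y‖ <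
        (ε + 2 * (α + β) * Real.sin (Real.pi / (2 * N + 2))) * ‖y‖ := by
  set B := A - lam • (1 : L2Z →L[ℂ] L2Z) with hB
  set σ := Real.sin (Real.pi / (2 * N + 2)) with hσ
  set S := ∑ j ∈ Finset.range (N + 1), Real.sin (j * (Real.pi / (N + 1))) ^ 2 with hSdef
  have hS : 0 < S := sum_sin_sq_pos hN
  have hσ0 : 0 ≤ σ := by
    refine Real.sin_nonneg_of_nonneg_of_le_pi (by positivity) ?_
    exact div_le_self Real.pi_pos.le (by linarith [Nat.cast_nonneg (α := ℝ) N])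
  have hα0 : 0 ≤ α := (norm_nonneg _).trans (hα 0)
  have hβ0 : 0 ≤ β := (norm_nonneg _).trans (hβ 0)
  obtain ⟨X, hX, hXs⟩ := exists_cutoff b c (hasSum_sineWeight_sq N) x
  obtain ⟨U, hU, hUs⟩ := exists_cutoff b c (hasSum_sineWeight_sq N) (B x)
  obtain ⟨P, hP, hPs⟩ := exists_cutoff b c (hasSum_sineWeight_sub_sq N) x
  obtain ⟨Q, hQ, hQs⟩ := exists_cutoff b c (hasSum_sineWeight_sub_sq' N) x
  choose Y hY hYn using fun m => exists_diagPart A b c (-1) hα (P m)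
  choose Z hZ hZn using fun m => exists_diagPart A b c 1 hβ (Q m)
  have hBapp : ∀ z : L2Z, ∀ i, B z i = A z i - lam * z i := fun z i => rfl
  -- Commutator identity: in row block k, the neighbour k ± 1 carries w(k ± 1 - m), which is w(k -
  -- m) plus a difference of w taken at k ± 1 - m.
  have hsplit : ∀ m, B (X m) = U m + Y m + Z m := by
    intro m
    ext i
    have e1 : (U m + Y m + Z m : L2Z) i = U m i + Y m i + Z m i := rfl
    rw [e1, hBapp, hU, hBapp, hY, hZ, hX, apply_eq_sum_diagPart A hA c, apply_eq_sum_diagPart A hA c,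
      diagPart_cutoff A b c 0 m (hX m), diagPart_cutoff A b c (-1) m (hX m),
      diagPart_cutoff A b c 1 m (hX m),
      diagPart_cutoff A b c (-1) m (w := fun i => sineWeight N i - sineWeight N (i + 1)) (hP m),
      diagPart_cutoff A b c 1 m (w := fun i => sineWeight N i - sineWeight N (i - 1)) (hQ m)]
    rw [show blockIndex b c i + -1 - m + 1 = blockIndex b c i - m by ring,
      show blockIndex b c i + 1 - m - 1 = blockIndex b c i - m by ring, add_zero]
    push_cast
    ring
  obtain ⟨m, hm⟩ := exists_norm_add_lt_of_hasSum hS (norm_nonneg (B x)) (norm_nonneg x)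
    (mul_nonneg zero_le_two hσ0) hα0 hβ0 hε hXs hUs hPs hQs hYn hZn hx
  rw [← hsplit, show (α + β) * (2 * σ) = 2 * (α + β) * σ by ring] at hm
  -- The translated weight lives on blocks m + 1, …, m + N, and block m + 1 begins at c + b(m + 1) +
  -- 1.
  refine ⟨c + b * (m + 1), ⟨m + 1, rfl⟩, X m, ?_, hm⟩
  intro j hj
  rw [hX]
  have : sineWeight N (blockIndex b c j - m) = 0 := by
    refine if_neg fun hmem => hj ?_
    obtain ⟨⟨k, p⟩, rfl⟩ := (blockEquiv b c).surjective j
    rw [blockIndex_blockEquiv] at hmem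
    have hp := p.2
    have h1 : (b : ℤ) * (m + 1) ≤ b * k := by gcongr; omega
    have h2 : (b : ℤ) * k ≤ b * (m + N) := by gcongr; omega
    rw [blockEquiv_apply]
    simp only [window, Set.mem_Icc]
    push_cast
    constructor
    · omega
    · nlinarith
  simp [this]

/-! ### Band structure, adjoints and bounds on blocks -/

theorem natAbs_sub_le_of_entry_ne_zero {A : L2Z →L[ℂ] L2Z} (hA : IsBandOperator A) {b : ℕ}
    (hb : bandwidth A ≤ b) {i j : ℤ} (h : entry A i j ≠ 0) : (i - j).natAbs ≤ b := by
  refine le_trans (le_csSup (s := {m : ℕ | ∃ i j : ℤ, entry A i j ≠ 0 ∧ m = (i - j).natAbs})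
    ?_ ⟨i, j, h, rfl⟩) hb
  -- Finitely many diagonals make the supremum genuine; `sSup` of an unbounded set of naturals is 0.
  refine Set.Finite.bddAbove ((hA.image Int.natAbs).subset ?_)
  rintro _ ⟨i, j, hij, rfl⟩
  exact ⟨i - j, ⟨i, j, hij, rfl⟩, rfl⟩

theorem entry_adjoint (A : L2Z →L[ℂ] L2Z) (i j : ℤ) :
    entry (ContinuousLinearMap.adjoint A) i j = star (entry A j i) := by
  have h1 := lp.inner_single_left (𝕜 := ℂ) (G := fun _ : ℤ => ℂ) i (1 : ℂ)
    (ContinuousLinearMap.adjoint A (lp.single 2 j (1 : ℂ)))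
  have h2 := lp.inner_single_right (𝕜 := ℂ) (G := fun _ : ℤ => ℂ) j (1 : ℂ)
    (A (lp.single 2 i (1 : ℂ)))
  rw [ContinuousLinearMap.adjoint_inner_right, h2] at h1
  simpa [entry] using h1.symm

theorem block_adjoint (A : L2Z →L[ℂ] L2Z) (b : ℕ) (c k l : ℤ) :
    block (ContinuousLinearMap.adjoint A) b c k l = (block A b c l k).conjTranspose := by
  ext p q
  simp [block, entry_adjoint]

theorem opNorm_conjTranspose {b : ℕ} (M : Matrix (Fin b) (Fin b) ℂ) :
    opNorm M.conjTranspose = opNorm M := by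
  rw [opNorm, opNorm, ← Matrix.star_eq_conjTranspose, map_star]
  exact ContinuousLinearMap.adjoint.norm_map _

theorem norm_entry_le (A : L2Z →L[ℂ] L2Z) (i j : ℤ) : ‖entry A i j‖ ≤ ‖A‖ := by
  refine (lp.norm_apply_le_norm two_ne_zero _ i).trans ((A.le_opNorm _).trans ?_)
  rw [lp.norm_single (by norm_num), norm_one, mul_one]

/-- Entries are bounded by ‖A‖, and a linear map on a finite-dimensional space is continuous. This
keeps the suprema in `delta` from taking the default value 0. -/
theorem exists_opNorm_block_le (A : L2Z →L[ℂ] L2Z) (b : ℕ) (c : ℤ) :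
    ∃ C, ∀ k l, opNorm (block A b c k l) ≤ C := by
  let T : (Fin b → Fin b → ℂ) →ₗ[ℂ] (EuclideanSpace ℂ (Fin b) →L[ℂ] EuclideanSpace ℂ (Fin b)) :=
    (Matrix.toEuclideanCLM (n := Fin b) (𝕜 := ℂ)).toAlgEquiv.toLinearMap ∘ₗ
      (Matrix.ofLinearEquiv ℂ).toLinearMap
  refine ⟨‖LinearMap.toContinuousLinearMap T‖ * ‖A‖, fun k l => ?_⟩
  refine ((LinearMap.toContinuousLinearMap T).le_opNorm (block A b c k l)).trans ?_
  gcongr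
  refine (pi_norm_le_iff_of_nonneg (norm_nonneg _)).2 fun p => ?_
  exact (pi_norm_le_iff_of_nonneg (norm_nonneg _)).2 fun q => norm_entry_le A _ _

theorem bddAbove_opNorm_block (A : L2Z →L[ℂ] L2Z) (b : ℕ) (c : ℤ) (f g : ℤ → ℤ) :
    BddAbove (Set.range fun l => opNorm (block A b c (f l) (g l))) := by
  obtain ⟨C, hC⟩ := exists_opNorm_block_le A b c
  exact ⟨C, by rintro _ ⟨l, rfl⟩; exact hC _ _⟩

theorem opNorm_block_le_iSup_lower (A : L2Z →L[ℂ] L2Z) (b : ℕ) (c k : ℤ) :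
    opNorm (block A b c (k + 1) k) ≤ ⨆ l : ℤ, opNorm (block A b c (l + 1) l) :=
  le_ciSup (bddAbove_opNorm_block A b c (· + 1) id) k

theorem opNorm_block_le_iSup_upper (A : L2Z →L[ℂ] L2Z) (b : ℕ) (c k : ℤ) :
    opNorm (block A b c (k - 1) k) ≤ ⨆ l : ℤ, opNorm (block A b c (l - 1) l) :=
  le_ciSup (bddAbove_opNorm_block A b c (· - 1) id) k

/-! ### The upper inclusion and the convergence rate -/

theorem pseudospectrum_subset_gammaSet (A : L2Z →L[ℂ] L2Z) {b : ℕ} [NeZero b]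
    (hA : ∀ i j, entry A i j ≠ 0 → (i - j).natAbs ≤ b) (c : ℤ) {N : ℕ} (hN : 0 < N) {ε : ℝ}
    (hε : 0 < ε) :
    pseudospectrum A ε ⊆ gammaSet A (N * b) (offsetSet b c) (ε + delta A b c N) := by
  intro lam h
  rw [mem_pseudospectrum_iff A hε] at h
  rw [mem_gammaSet_iff A (Nat.mul_pos hN (Nat.pos_of_neZero b))]
  have hlow : ∀ k, opNorm (block A b c k (k + -1)) ≤ ⨆ l : ℤ, opNorm (block A b c (l + 1) l) := by
    intro k
    simpa using opNorm_block_le_iSup_lower A b c (k + -1)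
  have hup : ∀ k, opNorm (block A b c k (k + 1)) ≤ ⨆ l : ℤ, opNorm (block A b c (l - 1) l) := by
    intro k
    simpa using opNorm_block_le_iSup_upper A b c (k + 1)
  rcases h with ⟨x, hx⟩ | ⟨x, hx⟩
  · obtain ⟨k, hk, y, hy, hlt⟩ := exists_window_norm_lt A hA c hN hlow hup lam hε hx
    exact ⟨k, hk, Or.inl ⟨y, hy, hlt⟩⟩
  -- Passing to the adjoint exchanges the lower and upper block diagonals, and `delta` is symmetric
  -- in the two suprema.
  · have hadj : ContinuousLinearMap.adjoint (A - lam • (1 : L2Z →L[ℂ] L2Z)) =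
        ContinuousLinearMap.adjoint A - (star lam) • (1 : L2Z →L[ℂ] L2Z) := by
      simp only [← ContinuousLinearMap.star_eq_adjoint, star_sub, star_smul, star_one]
    rw [hadj] at hx ⊢
    have hA' : ∀ i j, entry (ContinuousLinearMap.adjoint A) i j ≠ 0 → (i - j).natAbs ≤ b := by
      intro i j hij
      rw [entry_adjoint, star_ne_zero] at hij
      have := hA j i hij
      omega
    have hlow' : ∀ k, opNorm (block (ContinuousLinearMap.adjoint A) b c k (k + -1)) ≤
        ⨆ l : ℤ, opNorm (block A b c (l - 1) l) := by
      intro k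
      rw [block_adjoint, opNorm_conjTranspose]
      exact opNorm_block_le_iSup_upper A b c k
    have hup' : ∀ k, opNorm (block (ContinuousLinearMap.adjoint A) b c k (k + 1)) ≤
        ⨆ l : ℤ, opNorm (block A b c (l + 1) l) := by
      intro k
      rw [block_adjoint, opNorm_conjTranspose]
      exact opNorm_block_le_iSup_lower A b c k
    obtain ⟨k, hk, y, hy, hlt⟩ := exists_window_norm_lt _ hA' c hN hlow' hup' _ hε hx
    refine ⟨k, hk, Or.inr ⟨y, hy, ?_⟩⟩
    rw [delta, add_comm (⨆ l : ℤ, opNorm (block A b c (l + 1) l))]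
    exact hlt

theorem delta_isBigO (A : L2Z →L[ℂ] L2Z) (b : ℕ) (c : ℤ) :
    (fun N : ℕ => delta A b c N) =O[Filter.atTop] (fun N : ℕ => 1 / (N : ℝ)) := by
  unfold delta
  refine Asymptotics.IsBigO.const_mul_left (Asymptotics.IsBigO.of_bound Real.pi ?_) _
  filter_upwards [Filter.eventually_gt_atTop 0] with N hN
  have hN' : (0 : ℝ) < N := by exact_mod_cast hN
  rw [Real.norm_eq_abs, Real.norm_of_nonneg (by positivity), mul_one_div]
  refine Real.abs_sin_le_abs.trans ?_
  rw [abs_of_nonneg (by positivity)]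
  exact div_le_div_of_nonneg_left Real.pi_pos.le hN' (by linarith)

end BandOp

end

theorem mainTheorem2 (A : BandOp.L2Z →L[ℂ] BandOp.L2Z) (hA : BandOp.IsBandOperator A)
    (b : ℕ) (hb : 0 < b) (hbw : BandOp.bandwidth A ≤ b) :
    (∀ N : ℕ, 0 < N → ∀ ε : ℝ, 0 < ε →
      -- for every single offset
      (∀ c : Fin b,
        BandOp.gammaSet A (N * b) (BandOp.offsetSet b (c : ℕ)) ε ⊆ BandOp.pseudospectrum A ε ∧
        BandOp.pseudospectrum A ε ⊆
          BandOp.gammaSet A (N * b) (BandOp.offsetSet b (c : ℕ))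
            (ε + BandOp.delta A b (c : ℕ) N)) ∧
      -- union and intersection over all offsets, each with its own error bound
      (⋃ c : Fin b, BandOp.gammaSet A (N * b) (BandOp.offsetSet b (c : ℕ)) ε) ⊆
        BandOp.pseudospectrum A ε ∧
      BandOp.pseudospectrum A ε ⊆
        (⋂ c : Fin b, BandOp.gammaSet A (N * b) (BandOp.offsetSet b (c : ℕ))
          (ε + BandOp.delta A b (c : ℕ) N)) ∧
      -- the same with one common error bound
      BandOp.pseudospectrum A ε ⊆
        (⋂ c : Fin b, BandOp.gammaSet A (N * b) (BandOp.offsetSet b (c : ℕ))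
          (ε + ⨆ c' : Fin b, BandOp.delta A b (c' : ℕ) N))) ∧
    -- the rate of the error bounds, as `N → ∞`, in terms of `N` and of `n = N * b`
    (∀ c : Fin b,
      (fun N : ℕ => BandOp.delta A b (c : ℕ) N) =O[Filter.atTop] (fun N : ℕ => 1 / (N : ℝ)) ∧
      (fun N : ℕ => BandOp.delta A b (c : ℕ) N) =O[Filter.atTop]
        (fun N : ℕ => 1 / ((N * b : ℕ) : ℝ))) := by
  have : NeZero b := ⟨hb.ne'⟩
  have hband : ∀ i j, BandOp.entry A i j ≠ 0 → (i - j).natAbs ≤ b := fun i j =>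
    BandOp.natAbs_sub_le_of_entry_ne_zero hA hbw
  refine ⟨fun N hN ε hε => ?_, fun c => ⟨BandOp.delta_isBigO A b _, ?_⟩⟩
  · have hlower : ∀ c : Fin b, BandOp.gammaSet A (N * b) (BandOp.offsetSet b (c : ℕ)) ε ⊆
        BandOp.pseudospectrum A ε := fun c =>
      BandOp.gammaSet_subset_pseudospectrum A (Nat.mul_pos hN hb) _ hε
    have hupper : ∀ c : Fin b, BandOp.pseudospectrum A ε ⊆
        BandOp.gammaSet A (N * b) (BandOp.offsetSet b (c : ℕ))
          (ε + BandOp.delta A b (c : ℕ) N) := fun c =>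
      BandOp.pseudospectrum_subset_gammaSet A hband _ hN hε
    refine ⟨fun c => ⟨hlower c, hupper c⟩, Set.iUnion_subset hlower,
      Set.subset_iInter hupper, Set.subset_iInter fun c => (hupper c).trans ?_⟩
    refine BandOp.gammaSet_mono A _ _ ?_
    gcongr
    exact le_ciSup (f := fun c' : Fin b => BandOp.delta A b (c' : ℕ) N)
      (Set.finite_range _).bddAbove c
  -- The constant b comes from 1/N = b · 1/(Nb), which also holds at N = 0, where both sides are 0
  -- by convention.
  · refine (BandOp.delta_isBigO A b _).trans (Asymptotics.IsBigO.of_bound b ?_)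
    filter_upwards with N
    have hb' : (b : ℝ) ≠ 0 := by exact_mod_cast hb.ne'
    rw [Real.norm_of_nonneg (by positivity), Real.norm_of_nonneg (by positivity)]
    push_cast
    rw [mul_one_div, mul_comm (N : ℝ), ← div_div, div_self hb']
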